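/- Graphs are finite and may have loops and multiple edges. An \emph{euler circuit} of a graph $G$ is a closed walk, considered up to cyclic shifts, that traverses every edge of $G$ exactly once and visits every vertex; $G$ is \emph{eulerian} if it has one, and \emph{nontrivial} if it has at least one edge. A \emph{cycle} is a connected graph in which every vertex has degree $2$ (a loop counts $2$ towards the degree, so a vertex with a loop and a pair of vertices joined by two parallel edges are cycles). All embeddings of graphs in surfaces are cellular and may be orientable or nonorientable. The \emph{Euler genus} $\gamma$ of an embedding with face set $F$ of a connected graph with vertex set $V$ and edge set $E$ is given by $|V|-|E|+|F|=2-\gamma$; the \emph{genus} is $\gamma/2$ if the surface is orientable and $\gamma$ if it is nonorientable. An embedding is \emph{bi-eulerian} if it has exactly two faces, each bounded by an euler circuit. Let $G$ be a nontrivial eulerian graph with $n$ vertices and $m$ edges, and let $T$ be an euler circuit of $G$. Then: (1) $G$ has a bi-eulerian embedding in which one of the faces is bounded by $T$. (2) $G$ has a nonorientable bi-eulerian embedding in which one of the faces is bounded by $T$ if and only if $G$ is not a cycle. (3) Every bi-eulerian embedding $\Phi$ of $G$ in which one of the faces is bounded by $T$ has Euler genus $m-n$, and this is the maximum Euler genus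 over all embeddings of $G$ with a face bounded by $T$. Consequently, if $\Phi$ is orientable, then it has maximum genus over all orientable embeddings of $G$ with a face bounded by $T$, and if $\Phi$ is nonorientable, then it has maximum genus over all nonorientable embeddings of $G$ with a face bounded by $T$. -/

import Mathlib

/-- A graph, with loops and multiple edges allowed, on the vertex type `V` with half-edge type `H`.
Every half-edge `h` is incident with the vertex `inc h`, and `mate` is a fixed-point-free involution
pairing the two halves of each edge. -/
structure HalfEdgeGraph (V : Type*) (H : Type*) where
  inc : H → V
  mate : H → H
  mate_mate : ∀ h, mate (mate h) = h
  mate_ne : ∀ h, mate h ≠ h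

namespace HalfEdgeGraph

variable {V : Type*} {H : Type*} (G : HalfEdgeGraph V H)

/-- The edge containing a half-edge, as the unordered pair of its two halves. -/
def edge (h : H) : Sym2 H := s(h, G.mate h)

/-- The set of edges. -/
def edgeSet : Set (Sym2 H) := Set.range G.edge

/-- The degree of a vertex is its number of half-edges, so a loop counts twice. -/
noncomputable def degree (v : V) : ℕ := (G.inc ⁻¹' {v}).ncard

/-- A graph is nontrivial if it has at least one edge. -/
def Nontrivial : Prop := G.edgeSet.Nonempty

/-- Any two vertices are joined by a walk, and there is at least one vertex. -/
def Connected : Prop :=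
  Nonempty V ∧
    ∀ u v : V, Relation.ReflTransGen (fun a b => ∃ h, G.inc h = a ∧ G.inc (G.mate h) = b) u v

/-- `G` is a cycle: it is connected and `2`-regular. One vertex with a loop, and two vertices joined
by two parallel edges, are the cycles of length `1` and `2`. -/
def IsCycle : Prop := G.Connected ∧ ∀ v, G.degree v = 2

/-- Closed walks `(v₀ g₁ h₁ v₁ … g_ℓ h_ℓ)`, up to cyclic shifts, of positive length are recorded as
the cyclic sequence of their departing half-edges `g₁, …, g_ℓ`; then `hᵢ = mate gᵢ` and
`vᵢ = inc hᵢ = inc gᵢ₊₁`. -/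
def IsClosedWalk (c : Cycle H) : Prop := c.Chain fun g g' => G.inc (G.mate g) = G.inc g'

/-- A circuit is a closed walk without repeated edges. -/
def IsCircuit (c : Cycle H) : Prop := G.IsClosedWalk c ∧ (c.map G.edge).Nodup

/-- An euler circuit is a circuit that contains all the edges and all the vertices. -/
def IsEulerCircuit (c : Cycle H) : Prop :=
  G.IsCircuit c ∧ (∀ e ∈ G.edgeSet, e ∈ c.map G.edge) ∧ ∀ v, v ∈ c.map G.inc

/-- A cellular embedding of a (connected) graph, represented by a rotation system with edge
signatures: `rot` permutes the half-edges at each vertex in a single cycle (the local clockwise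
order), and `sig` gives a sign to each edge (`-1` if the edge is twisted, that is, if the chosen
local orientations at its ends disagree along it). -/
structure CellularEmbedding where
  rot : Equiv.Perm H
  inc_rot : ∀ h, G.inc (rot h) = G.inc h
  rot_sameCycle : ∀ h h', G.inc h = G.inc h' → rot.SameCycle h h'
  sig : H → ℤˣ
  sig_mate : ∀ h, sig (G.mate h) = sig h

namespace CellularEmbedding

variable {G} (Φ : G.CellularEmbedding)

/-- One step of face tracing. In the state `(h, s)` we leave a vertex along `h`, and `s` tells
whether we follow the local orientation at that vertex or its opposite. We traverse the edge,
switch sides if it is twisted, and leave along the next half-edge in the current sense. -/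
def faceStep (x : H × ℤˣ) : H × ℤˣ :=
  ((Φ.rot ^ ((x.2 * Φ.sig x.1 : ℤˣ) : ℤ)) (G.mate x.1), x.2 * Φ.sig x.1)

/-- The state that traverses the same side of the same edge in the opposite direction. -/
def reverse (x : H × ℤˣ) : H × ℤˣ := (G.mate x.1, -(x.2 * Φ.sig x.1))

/-- The faces: states are identified when they trace the same face, in either direction. -/
def Face : Type _ := Quot fun x y : H × ℤˣ => y = Φ.faceStep x ∨ y = Φ.reverse x

/-- The face traced from a state. -/
def faceOf (x : H × ℤˣ) : Φ.Face := Quot.mk _ x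

/-- The closed walk traced out from a state. -/
noncomputable def facialWalk (x : H × ℤˣ) : Cycle H :=
  (((List.iterate Φ.faceStep x (Function.minimalPeriod Φ.faceStep x)).map Prod.fst : List H) :
    Cycle H)

/-- The face `f` is bounded by the closed walk `c`, regardless of the direction of traversal. -/
def IsBoundedBy (f : Φ.Face) (c : Cycle H) : Prop := ∃ x, Φ.faceOf x = f ∧ Φ.facialWalk x = c

/-- Some face is bounded by `c`. -/
def HasFaceBoundedBy (c : Cycle H) : Prop := ∃ f, Φ.IsBoundedBy f c

/-- There are exactly two faces, each bounded by an euler circuit. -/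
def IsBiEulerian : Prop :=
  Nat.card Φ.Face = 2 ∧ ∀ f, ∃ c, G.IsEulerCircuit c ∧ Φ.IsBoundedBy f c

/-- The surface is orientable: the local orientations at the vertices can be reversed (where
`ε v = -1`) so that they agree along every edge. -/
def IsOrientable : Prop := ∃ ε : V → ℤˣ, ∀ h, Φ.sig h = ε (G.inc h) * ε (G.inc (G.mate h))

/-- The Euler genus `γ` of the surface, given by Euler's formula `|V| - |E| + |F| = 2 - γ` (for a
connected nontrivial graph). -/
noncomputable def eulerGenus : ℤ :=
  2 - ((Nat.card V : ℤ) - (G.edgeSet.ncard : ℤ) + (Nat.card Φ.Face : ℤ))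

open Classical in
/-- The genus of the surface: half of the Euler genus if it is orientable, and equal to the Euler
genus if it is nonorientable. (Rational division, so that nothing is rounded.) -/
noncomputable def genus : ℚ :=
  if Φ.IsOrientable then (Φ.eulerGenus : ℚ) / 2 else (Φ.eulerGenus : ℚ)

end CellularEmbedding

end HalfEdgeGraph

/-! The corners of a face pair up half-edges at vertices, so an euler circuit `T` amounts to an
involution `τ` on half-edges that preserves `inc` and is transitive together with `G.mate`. A
bi-eulerian embedding with face `T` therefore amounts to a second such involution `ν` for which `τ`
and `ν` alternate once around each vertex, that is, the classes of `τ` and `ν` are the fibers of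
`inc`.

To find `ν`, modify a copy of `τ` by switches. A switch at two points of equal color in a common
proper 2-coloring never splits a class (`linkSetoid_switch`, by counting colors). Given two classes
of `τ, ν` at one vertex, the switch points can be chosen with equal color for `mate, ν`; since they
lie in different classes of `τ, ν`, equal color can be arranged there too. Hence the switch merges
the two classes and keeps `mate, ν` transitive (`exists_reconnection`).

For nonorientability, let `c` be +1 on the half-edges by which `T` departs and -1 on the others.
Orientability would force `ν` to reverse `c` (`exists_isBiEulerian`). Unless `G` is a cycle, some
vertex has room for a first switch of `τ` that joins two points of the same color, and that pair can
be kept. On a cycle, `T` visits each vertex once, and its sense there gives a global orientation.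

Maximality is Euler's formula: a face bounded by a circuit uses only one side of each edge, so there
is a second face (`two_le_card_face`). -/

/-- The equivalence relation generated by two maps; for involutions, its classes are the orbits of
the dihedral group that they generate. -/
def linkSetoid {H : Type*} (a b : H → H) : Setoid H :=
  Relation.EqvGen.setoid fun x y => y = a x ∨ y = b x

/-! ### Dihedral orbits and 2-colorings of two involutions -/

section Involutions

variable {H : Type*} {a b σ : H → H}

theorem linkSetoid_left (a b : H → H) (x : H) : linkSetoid a b x (a x) :=
  Relation.EqvGen.rel _ _ (Or.inl rfl)

theorem linkSetoid_right (a b : H → H) (x : H) : linkSetoid a b x (b x) :=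
  Relation.EqvGen.rel _ _ (Or.inr rfl)

theorem linkSetoid_le {s : Setoid H} (ha : ∀ x, s x (a x)) (hb : ∀ x, s x (b x)) :
    linkSetoid a b ≤ s :=
  Setoid.eqvGen_le (by rintro x y (rfl | rfl); exacts [ha x, hb x])

theorem linkSetoid_comm (a b : H → H) : linkSetoid a b = linkSetoid b a :=
  le_antisymm (linkSetoid_le (linkSetoid_right b a) (linkSetoid_left b a))
    (linkSetoid_le (linkSetoid_right a b) (linkSetoid_left a b))

/-- An invariant of both maps is constant on the classes. -/
theorem linkSetoid_apply_eq {β : Type*} {f : H → β} (ha : ∀ x, f (a x) = f x)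
    (hb : ∀ x, f (b x) = f x) {x y : H} (h : linkSetoid a b x y) : f x = f y :=
  linkSetoid_le (s := Setoid.ker f) (fun x => (ha x).symm) (fun x => (hb x).symm) h

/-- The product of two involutions. -/
def involutionProd (ha : a.Involutive) (hb : b.Involutive) : Equiv.Perm H :=
  ha.toPerm * hb.toPerm

theorem involutionProd_apply (ha : a.Involutive) (hb : b.Involutive) (x : H) :
    involutionProd ha hb x = a (b x) := rfl

theorem involutionProd_zpow_apply (ha : a.Involutive) (hb : b.Involutive) (i : ℤ) (x : H) :
    (involutionProd ha hb ^ i) (b x) = b ((involutionProd ha hb ^ (-i)) x) := by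
  have h1 : hb.toPerm * involutionProd ha hb * hb.toPerm⁻¹ = (involutionProd ha hb)⁻¹ := by
    rw [eq_inv_iff_mul_eq_one]
    ext z
    change b (a (b (b (a (b z))))) = z
    rw [hb, ha, hb]
  have h2 : hb.toPerm * involutionProd ha hb ^ (-i) * hb.toPerm⁻¹ = involutionProd ha hb ^ i := by
    rw [← conj_zpow, h1, inv_zpow', neg_neg]
  rw [← h2]
  change b ((involutionProd ha hb ^ (-i)) (b (b x))) = _
  rw [hb]

/-- Two points in the same class of two involutions are joined, up to one application of `b`, by
iterating the product. -/
theorem sameCycle_or_of_linkSetoid (ha : a.Involutive) (hb : b.Involutive) {x y : H}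
    (h : linkSetoid a b x y) :
    (involutionProd ha hb).SameCycle x y ∨ (involutionProd ha hb).SameCycle x (b y) := by
  have hconj : ∀ x y, (involutionProd ha hb).SameCycle x y →
      (involutionProd ha hb).SameCycle (b x) (b y) := by
    rintro x y ⟨i, rfl⟩
    exact ⟨-i, by rw [involutionProd_zpow_apply, neg_neg]⟩
  have key : linkSetoid a b ≤
      { r := fun x y => (involutionProd ha hb).SameCycle x y ∨
          (involutionProd ha hb).SameCycle x (b y)
        iseqv :=
          { refl := fun x => Or.inl (Equiv.Perm.SameCycle.refl _ _)
            symm := by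
              rintro x y (h | h)
              · exact Or.inl h.symm
              · right
                have := hconj _ _ h.symm
                rwa [hb] at this
            trans := by
              rintro x y z (h | h) (h' | h')
              · exact Or.inl (h.trans h')
              · exact Or.inr (h.trans h')
              · exact Or.inr (h.trans (hconj _ _ h'))
              · left
                have := hconj _ _ h'
                rw [hb] at this
                exact h.trans this } } := by
    apply linkSetoid_le
    · intro x
      refine Or.inr (Equiv.Perm.SameCycle.symm ⟨1, ?_⟩)
      rw [zpow_one, involutionProd_apply, hb, ha]
    · intro x
      exact Or.inr (by rw [hb])
  exact key h

/-- For fixed-point-free involutions, `x` and `b x` are in different cycles of the product. -/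
theorem not_sameCycle_apply (ha : a.Involutive) (hb : b.Involutive) (ha' : ∀ x, a x ≠ x)
    (hb' : ∀ x, b x ≠ x) (x : H) : ¬ (involutionProd ha hb).SameCycle x (b x) := by
  rintro ⟨i, hi⟩
  set q := involutionProd ha hb with hq
  -- A reflection that acts on `x` as a rotation does so fixes the midpoint of the path from `x` to
  -- `b x`: for even `i` this is a fixed point of `b`, for odd `i` one of `a`.
  obtain ⟨j, rfl | rfl⟩ := Int.even_or_odd' i
  · apply hb' ((q ^ j) x)
    have h : (q ^ j) ((q ^ j) x) = b x := by
      rw [← Equiv.Perm.mul_apply, ← zpow_add, ← two_mul, hi]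
    apply (q ^ j).injective
    rw [involutionProd_zpow_apply, ← Equiv.Perm.mul_apply, ← zpow_add, neg_add_cancel, h, zpow_zero,
      Equiv.Perm.one_apply]
  · apply ha' (b ((q ^ j) x))
    have h : (q ^ j) (q ((q ^ j) x)) = b x := by
      rw [← Equiv.Perm.mul_apply, ← Equiv.Perm.mul_apply, ← zpow_add_one, ← zpow_add,
        show j + 1 + j = 2 * j + 1 by ring, hi]
    apply (q ^ j).injective
    rw [← involutionProd_apply ha hb, ← hq, h, involutionProd_zpow_apply, ← Equiv.Perm.mul_apply,
      ← zpow_add, neg_add_cancel, zpow_zero, Equiv.Perm.one_apply]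

/-- Two fixed-point-free involutions have a common proper `2`-coloring. -/
theorem exists_coloring (ha : a.Involutive) (hb : b.Involutive) (ha' : ∀ x, a x ≠ x)
    (hb' : ∀ x, b x ≠ x) : ∃ c : H → ℤˣ, (∀ x, c (a x) = -c x) ∧ ∀ x, c (b x) = -c x := by
  classical
  let rep : H → H := fun x => (Quotient.mk (linkSetoid a b) x).out
  have hrep : ∀ x, linkSetoid a b (rep x) x := fun x => Quotient.mk_out (s := linkSetoid a b) x
  have hrepa : ∀ x, rep (a x) = rep x := fun x =>
    congrArg Quotient.out (Quotient.sound ((linkSetoid a b).symm (linkSetoid_left a b x)))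
  have hrepb : ∀ x, rep (b x) = rep x := fun x =>
    congrArg Quotient.out (Quotient.sound ((linkSetoid a b).symm (linkSetoid_right a b x)))
  -- Each class consists of two cycles of the product, exchanged by `a` and by `b`; the color tells
  -- whether a point shares the cycle of the chosen representative.
  have hb2 : ∀ x, (involutionProd ha hb).SameCycle (rep x) (b x) ↔
      ¬ (involutionProd ha hb).SameCycle (rep x) x := fun x =>
    ⟨fun h h' => not_sameCycle_apply ha hb ha' hb' x (h'.symm.trans h),
      (sameCycle_or_of_linkSetoid ha hb (hrep x)).resolve_left⟩
  have ha2 : ∀ x, (involutionProd ha hb).SameCycle (rep x) (a x) ↔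
      (involutionProd ha hb).SameCycle (rep x) (b x) := fun x => by
    have := Equiv.Perm.sameCycle_apply_right (f := involutionProd ha hb) (x := rep x) (y := b x)
    rwa [involutionProd_apply, hb] at this
  refine ⟨fun x => if (involutionProd ha hb).SameCycle (rep x) x then 1 else -1, fun x => ?_,
    fun x => ?_⟩
  · simp only [hrepa, ha2, hb2]
    split_ifs <;> simp_all
  · simp only [hrepb, hb2]
    split_ifs <;> simp_all

/-! ### Switching an involution at two points -/

/-- Reconnect `{x, σ x}` and `{y, σ y}` to `{x, y}` and `{σ x, σ y}`. -/
def switch [DecidableEq H] (σ : H → H) (x y : H) : H → H :=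
  fun z => Equiv.swap (σ x) y (σ (Equiv.swap (σ x) y z))

section Switch

variable [DecidableEq H] {x y : H}

/-- A switch is the conjugate of `σ` by a transposition, so it inherits the properties of `σ`. -/
theorem switch_involutive (hσ : σ.Involutive) (x y : H) : (switch σ x y).Involutive := fun z => by
  simp [switch, hσ _]

theorem switch_ne (hσ' : ∀ z, σ z ≠ z) (x y z : H) : switch σ x y z ≠ z := fun h =>
  hσ' (Equiv.swap (σ x) y z) ((Equiv.swap (σ x) y).injective (by simpa [switch] using h))

theorem switch_apply_left (hσ' : ∀ z, σ z ≠ z) (hxy : x ≠ y) : switch σ x y x = y := by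
  rw [switch, Equiv.swap_apply_of_ne_of_ne (hσ' x).symm hxy, Equiv.swap_apply_left]

theorem switch_apply_apply_left (hσ : σ.Involutive) (hσ' : ∀ z, σ z ≠ z) (hxy : x ≠ y) :
    switch σ x y (σ x) = σ y := by
  rw [switch, Equiv.swap_apply_left, Equiv.swap_apply_of_ne_of_ne (hσ.injective.ne hxy.symm) (hσ' y)]

theorem switch_apply_of_ne (hσ : σ.Involutive) {z : H} (h1 : z ≠ x) (h2 : z ≠ y) (h3 : z ≠ σ x)
    (h4 : z ≠ σ y) : switch σ x y z = σ z := by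
  rw [switch, Equiv.swap_apply_of_ne_of_ne h3 h2,
    Equiv.swap_apply_of_ne_of_ne (hσ.injective.ne h1) (fun h => h4 (by rw [← h, hσ]))]

theorem apply_switch {β : Type*} {f : H → β} (hf : ∀ z, f (σ z) = f z) (h : f x = f y) (z : H) :
    f (switch σ x y z) = f z := by
  have hs : ∀ z, f (Equiv.swap (σ x) y z) = f z := fun z => by
    rw [Equiv.swap_apply_def]
    split_ifs with h1 h2
    · rw [h1, hf, h]
    · rw [h2, hf, h]
    · rfl
  rw [switch, hs, hf, hs]

/-- If `x` and `y` have the same color in a common proper `2`-coloring, then reconnecting at `x` and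
`y` keeps every class of `a` and `σ` together. -/
theorem linkSetoid_switch [Finite H] (ha : a.Involutive) (hσ : σ.Involutive) (hσ' : ∀ z, σ z ≠ z)
    {c : H → ℤˣ} (hca : ∀ z, c (a z) = -c z) (hcσ : ∀ z, c (σ z) = -c z) (hxy : x ≠ y)
    (hc : c x = c y) :
    linkSetoid a σ ≤ linkSetoid a (switch σ x y) ∧ linkSetoid a (switch σ x y) x y := by
  cases nonempty_fintype H
  set S := linkSetoid a (switch σ x y) with hS
  have h1 : S x y := by
    have := linkSetoid_right a (switch σ x y) x
    rwa [switch_apply_left hσ' hxy] at this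
  have h2 : S (σ x) (σ y) := by
    have := linkSetoid_right a (switch σ x y) (σ x)
    rwa [switch_apply_apply_left hσ hσ' hxy] at this
  -- Otherwise the new class `K` of `x` contains `x` and `y` but neither `σ x` nor `σ y`. The colors
  -- cancel over `K` in pairs under `a`, and over `K` without `x, y` in pairs under `σ`, so `c x + c
  -- y = 0`, against `hc`.
  have h3 : S x (σ x) := by
    by_contra h3
    have h4 : ¬ S x (σ y) := fun h => h3 (S.trans h (S.symm h2))
    classical
    let K : Finset H := Finset.univ.filter fun z => S x z
    have hK : ∀ z, z ∈ K ↔ S x z := fun z => by simp [K]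
    have hu : ∀ u : ℤˣ, (u : ℤ) ≠ 0 := fun u => u.ne_zero
    have sum1 : ∑ z ∈ K, (c z : ℤ) = 0 := by
      refine Finset.sum_involution (fun z _ => a z) (fun z _ => by rw [hca]; simp)
        (fun z _ hz h => ?_) (fun z hz => ?_) (fun z _ => ha z)
      · have := hca z
        rw [h] at this
        exact hu (c z) (by have := congrArg Units.val this; push_cast at this; omega)
      · rw [hK] at hz ⊢
        exact S.trans hz (linkSetoid_left _ _ z)
    have sum2 : ∑ z ∈ (K.erase x).erase y, (c z : ℤ) = 0 := by
      refine Finset.sum_involution (fun z _ => σ z) (fun z _ => by rw [hcσ]; simp)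
        (fun z _ hz h => hσ' z h) (fun z hz => ?_) (fun z _ => hσ z)
      simp only [Finset.mem_erase, hK] at hz ⊢
      obtain ⟨hzy, hzx, hz⟩ := hz
      have hzx' : z ≠ σ x := fun h => h3 (h ▸ hz)
      have hzy' : z ≠ σ y := fun h => h4 (h ▸ hz)
      refine ⟨fun h => hzy' (by rw [← h, hσ]), fun h => hzx' (by rw [← h, hσ]), S.trans hz ?_⟩
      rw [← switch_apply_of_ne hσ hzx hzy hzx' hzy']
      exact linkSetoid_right _ _ z
    have hx : x ∈ K := (hK x).2 (S.refl x)
    have hy : y ∈ K.erase x := Finset.mem_erase.2 ⟨hxy.symm, (hK y).2 h1⟩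
    have e1 := Finset.add_sum_erase K (fun z => (c z : ℤ)) hx
    have e2 := Finset.add_sum_erase (K.erase x) (fun z => (c z : ℤ)) hy
    refine hu (c y) ?_
    simp only [hc] at e1 e2
    omega
  refine ⟨linkSetoid_le (linkSetoid_left _ _) fun z => ?_, h1⟩
  by_cases hz1 : z = x
  · rw [hz1]; exact h3
  by_cases hz2 : z = y
  · rw [hz2]; exact S.trans (S.symm h1) (S.trans h3 h2)
  by_cases hz3 : z = σ x
  · rw [hz3, hσ]; exact S.symm h3
  by_cases hz4 : z = σ y
  · rw [hz4, hσ]; exact S.trans (S.symm h2) (S.trans (S.symm h3) h1)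
  rw [← switch_apply_of_ne hσ hz1 hz2 hz3 hz4]
  exact linkSetoid_right _ _ z

end Switch

end Involutions

/-! ### Merging classes inside the fibers -/

section Reconnect

variable {V H : Type*} {f : H → V} {μ τ σ : H → H}

/-- A common proper `2`-coloring can be chosen to agree at two points of different classes. -/
theorem exists_coloring_eq (hτ : τ.Involutive) (hτ' : ∀ z, τ z ≠ z) (hσ : σ.Involutive)
    (hσ' : ∀ z, σ z ≠ z) {x y : H} (hxy : ¬ linkSetoid τ σ x y) :
    ∃ c : H → ℤˣ, (∀ z, c (τ z) = -c z) ∧ (∀ z, c (σ z) = -c z) ∧ c x = c y := by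
  classical
  obtain ⟨c, hcτ, hcσ⟩ := exists_coloring hτ hσ hτ' hσ'
  have h1 : ∀ z, linkSetoid τ σ y (τ z) ↔ linkSetoid τ σ y z := fun z =>
    ⟨fun h => (linkSetoid τ σ).trans h ((linkSetoid τ σ).symm (linkSetoid_left _ _ z)),
      fun h => (linkSetoid τ σ).trans h (linkSetoid_left _ _ z)⟩
  have h2 : ∀ z, linkSetoid τ σ y (σ z) ↔ linkSetoid τ σ y z := fun z =>
    ⟨fun h => (linkSetoid τ σ).trans h ((linkSetoid τ σ).symm (linkSetoid_right _ _ z)),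
      fun h => (linkSetoid τ σ).trans h (linkSetoid_right _ _ z)⟩
  -- Multiplying by a constant sign on the class of `y` alone keeps the coloring proper.
  refine ⟨fun z => if linkSetoid τ σ y z then c z * (c x * c y) else c z, fun z => ?_, fun z => ?_,
    ?_⟩
  · simp only [h1, hcτ]; split_ifs <;> simp
  · simp only [h2, hcσ]; split_ifs <;> simp
  · have h3 : ¬ linkSetoid τ σ y x := fun h => hxy ((linkSetoid τ σ).symm h)
    have h4 : linkSetoid τ σ y y := (linkSetoid τ σ).refl y
    simp only [h3, h4, if_true, if_false]
    rw [mul_comm (c x), ← mul_assoc, Int.units_mul_self, one_mul]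

/-- The involution `σ` can be reconnected so that the classes of `τ` and `σ` become the fibers of
`f`, while `μ` and `σ` stay transitive and a given value `σ p ≠ τ p` is kept. -/
theorem exists_reconnection [Finite H] (hμ : μ.Involutive) (hμ' : ∀ z, μ z ≠ z) (hτ : τ.Involutive)
    (hτ' : ∀ z, τ z ≠ z) (hfτ : ∀ z, f (τ z) = f z) (hσ : σ.Involutive) (hσ' : ∀ z, σ z ≠ z)
    (hfσ : ∀ z, f (σ z) = f z) (hμσ : ∀ x y, linkSetoid μ σ x y) {p : H} (hp : σ p ≠ τ p) :
    ∃ ν : H → H, ν.Involutive ∧ (∀ z, ν z ≠ z) ∧ (∀ z, f (ν z) = f z) ∧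
      (∀ x y, linkSetoid μ ν x y) ∧ (∀ x y, f x = f y → linkSetoid τ ν x y) ∧ ν p = σ p := by
  classical
  induction hn : {z : H × H | ¬ linkSetoid τ σ z.1 z.2}.ncard using Nat.strong_induction_on
    generalizing σ with
  | _ n ih =>
  by_cases hdone : ∀ x y, f x = f y → linkSetoid τ σ x y
  · exact ⟨σ, hσ, hσ', hfσ, hμσ, hdone, rfl⟩
  push Not at hdone
  obtain ⟨x₀, y₀, hf₀, hxy₀⟩ := hdone
  -- The pair `{p, σ p}` must not be touched by the switch. As `σ p ≠ τ p`, applying `τ` leads out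
  -- of it without leaving the class or the fiber.
  have avoid : ∀ x, ∃ x', linkSetoid τ σ x x' ∧ f x' = f x ∧ x' ≠ p ∧ x' ≠ σ p := by
    intro x
    by_cases hx : x = p ∨ x = σ p
    · refine ⟨τ x, linkSetoid_left _ _ x, hfτ x, ?_⟩
      rcases hx with rfl | rfl
      · exact ⟨hτ' _, hp.symm⟩
      · exact ⟨fun h => hp (by rw [← hτ (σ p), h]), hτ' _⟩
    · push Not at hx
      exact ⟨x, (linkSetoid τ σ).refl x, rfl, hx⟩
  obtain ⟨x, hx, hfx, hxp, hxp'⟩ := avoid x₀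
  obtain ⟨y₁, hy₁, hfy₁, hyp₁, hyp₁'⟩ := avoid y₀
  obtain ⟨c, hcμ, hcσ⟩ := exists_coloring hμ hσ hμ' hσ'
  -- Passing from `y₁` to `σ y₁` flips the color and stays in the same class, in the same fiber and
  -- outside `{p, σ p}`.
  obtain ⟨y, hy, hfy, hyp, hyp', hc⟩ :
      ∃ y, linkSetoid τ σ y₀ y ∧ f y = f y₀ ∧ y ≠ p ∧ y ≠ σ p ∧ c x = c y := by
    rcases eq_or_ne (c x) (c y₁) with h | h
    · exact ⟨y₁, hy₁, hfy₁, hyp₁, hyp₁', h⟩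
    · refine ⟨σ y₁, (linkSetoid τ σ).trans hy₁ (linkSetoid_right _ _ _), (hfσ _).trans hfy₁,
        fun h => hyp₁' (by rw [← h, hσ]), fun h => hyp₁ (hσ.injective h), ?_⟩
      rw [hcσ, Int.units_ne_iff_eq_neg.1 h]
  have hxy : ¬ linkSetoid τ σ x y := fun h =>
    hxy₀ ((linkSetoid τ σ).trans hx ((linkSetoid τ σ).trans h ((linkSetoid τ σ).symm hy)))
  have hne : x ≠ y := fun h => hxy (h ▸ (linkSetoid τ σ).refl x)
  obtain ⟨d, hdτ, hdσ, hd⟩ := exists_coloring_eq hτ hτ' hσ hσ' hxy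
  obtain ⟨hle, -⟩ := linkSetoid_switch hμ hσ hσ' hcμ hcσ hne hc
  obtain ⟨hle', hxy'⟩ := linkSetoid_switch hτ hσ hσ' hdτ hdσ hne hd
  have hp' : switch σ x y p = σ p :=
    switch_apply_of_ne hσ hxp.symm hyp.symm (fun h => hxp' (by rw [h, hσ]))
      (fun h => hyp' (by rw [h, hσ]))
  rw [← hp']
  -- The number of unlinked pairs drops: no pair is separated and `(x, y)` becomes linked.
  refine ih _ ?_ (switch_involutive hσ x y) (switch_ne hσ' x y)
    (apply_switch hfσ (by rw [hfx, hfy, hf₀])) (fun u v => hle (hμσ u v)) (by rwa [hp']) rfl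
  rw [← hn]
  refine Set.ncard_lt_ncard ⟨fun z hz h => hz (hle' h), fun h => ?_⟩
  exact h (show (x, y) ∈ _ from hxy) hxy'

/-- If `τ` does not exhaust the fibers of `f`, there is an involution `ν` whose classes together with
`τ` are the fibers of `f`, which is transitive together with `μ`, and which joins two points of the
same color. -/
theorem exists_reconnection_of_color_eq [Finite H] (hμ : μ.Involutive)
    (hμ' : ∀ z, μ z ≠ z) (hτ : τ.Involutive) (hτ' : ∀ z, τ z ≠ z) (hfτ : ∀ z, f (τ z) = f z)
    (hμτ : ∀ x y, linkSetoid μ τ x y) {c : H → ℤˣ} (hcμ : ∀ z, c (μ z) = -c z)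
    (hcτ : ∀ z, c (τ z) = -c z) {x y : H} (hf : f x = f y) (hxy : x ≠ y) (hxy' : y ≠ τ x) :
    ∃ ν : H → H, ν.Involutive ∧ (∀ z, ν z ≠ z) ∧ (∀ z, f (ν z) = f z) ∧
      (∀ x y, linkSetoid μ ν x y) ∧ (∀ x y, f x = f y → linkSetoid τ ν x y) ∧
      ∃ z, c (ν z) = c z := by
  classical
  -- Replacing `y` by `τ y` flips its color and preserves the other conditions.
  wlog hc : c x = c y generalizing y
  · refine this (y := τ y) (by rw [hfτ, hf]) (fun h => hxy' (by rw [h, hτ]))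
      (fun h => hxy (hτ.injective h).symm) ?_
    rw [hcτ, Int.units_ne_iff_eq_neg.1 hc]
  obtain ⟨hle, -⟩ := linkSetoid_switch hμ hτ hτ' hcμ hcτ hxy hc
  have hx : switch τ x y x = y := switch_apply_left hτ' hxy
  obtain ⟨ν, h1, h2, h3, h4, h5, h6⟩ := exists_reconnection (f := f) hμ hμ' hτ hτ' hfτ
    (switch_involutive hτ x y) (switch_ne hτ' x y) (apply_switch hfτ hf)
    (fun u v => hle (hμτ u v)) (p := x) (by rwa [hx])
  exact ⟨ν, h1, h2, h3, h4, h5, x, by rw [h6, hx, hc]⟩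

end Reconnect

/-! ### Embeddings built from two families of corners -/

namespace HalfEdgeGraph

variable {V : Type*} {H : Type*} {G : HalfEdgeGraph V H}

namespace CellularEmbedding

theorem faceOf_faceStep (Φ : G.CellularEmbedding) (x : H × ℤˣ) :
    Φ.faceOf (Φ.faceStep x) = Φ.faceOf x :=
  (Quot.sound (r := fun x y => y = Φ.faceStep x ∨ y = Φ.reverse x) (Or.inl rfl)).symm

theorem faceOf_reverse (Φ : G.CellularEmbedding) (x : H × ℤˣ) :
    Φ.faceOf (Φ.reverse x) = Φ.faceOf x :=
  (Quot.sound (r := fun x y => y = Φ.faceStep x ∨ y = Φ.reverse x) (Or.inr rfl)).symm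

/-- The embedding whose corners are given by two families of transitions `t e`, for `e = ±1`, that
alternate around every vertex; `χ` colors the half-edges alternately around every vertex. -/
def ofTransitions (t : ℤˣ → H → H) (χ : H → ℤˣ) (ht : ∀ e, (t e).Involutive)
    (hχ : ∀ e h, χ (t e h) = -χ h) (hinc : ∀ e h, G.inc (t e h) = G.inc h)
    (hlink : ∀ h h', G.inc h = G.inc h' → linkSetoid (t (-1)) (t 1) h h') :
    G.CellularEmbedding where
  rot :=
    { toFun := fun h => t (-χ h) h
      invFun := fun h => t (χ h) h
      left_inv := fun h => by simp only [hχ]; exact ht _ h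
      right_inv := fun h => by simp only [hχ, neg_neg]; exact ht _ h }
  inc_rot h := hinc _ h
  rot_sameCycle h h' hh := by
    set rot : Equiv.Perm H :=
      { toFun := fun h => t (-χ h) h
        invFun := fun h => t (χ h) h
        left_inv := fun h => by simp only [hχ]; exact ht _ h
        right_inv := fun h => by simp only [hχ, neg_neg]; exact ht _ h } with hrot
    have key : ∀ e h, rot.SameCycle h (t e h) := by
      intro e h
      rcases Int.units_eq_one_or (e * χ h) with he | he
      · refine ⟨-1, ?_⟩
        rw [zpow_neg_one, mul_eq_one_iff_eq_inv.1 he, Int.units_inv_eq_self]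
        rfl
      · refine ⟨1, ?_⟩
        have : e = -χ h := by
          rw [← mul_one e, ← Int.units_mul_self (χ h), ← mul_assoc, he, neg_one_mul]
        rw [zpow_one, this]
        rfl
    exact linkSetoid_le (s := Equiv.Perm.SameCycle.setoid rot) (key _) (key _) (hlink h h' hh)
  sig h := -(χ h * χ (G.mate h))
  sig_mate h := by rw [G.mate_mate, mul_comm]

section OfTransitions

variable {t : ℤˣ → H → H} {χ : H → ℤˣ} {ht : ∀ e, (t e).Involutive}
  {hχ : ∀ e h, χ (t e h) = -χ h} {hinc : ∀ e h, G.inc (t e h) = G.inc h}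
  {hlink : ∀ h h', G.inc h = G.inc h' → linkSetoid (t (-1)) (t 1) h h'}

theorem ofTransitions_rot_zpow (s : ℤˣ) (h : H) :
    ((ofTransitions t χ ht hχ hinc hlink).rot ^ (s : ℤ)) h = t (-(s * χ h)) h := by
  rcases Int.units_eq_one_or s with rfl | rfl
  · simp [ofTransitions]
  · simp only [Units.val_neg, Units.val_one, zpow_neg_one, neg_mul, one_mul, neg_neg]
    rfl

/-- The sign `e = s * χ h` of a state `(h, s)` is invariant under face tracing and selects the
family of corners that the face uses. -/
theorem ofTransitions_faceStep (e : ℤˣ) (h : H) :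
    (ofTransitions t χ ht hχ hinc hlink).faceStep (h, e * χ h) =
      (t e (G.mate h), e * χ (t e (G.mate h))) := by
  have h1 : e * χ h * (ofTransitions t χ ht hχ hinc hlink).sig h = -(e * χ (G.mate h)) := by
    change e * χ h * -(χ h * χ (G.mate h)) = _
    rw [mul_neg, mul_assoc, ← mul_assoc (χ h), Int.units_mul_self, one_mul]
  simp only [faceStep, h1, ofTransitions_rot_zpow, hχ]
  simp [mul_assoc, Int.units_mul_self]

theorem ofTransitions_reverse (e : ℤˣ) (h : H) :
    (ofTransitions t χ ht hχ hinc hlink).reverse (h, e * χ h) =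
      (G.mate h, e * χ (G.mate h)) := by
  have h1 : e * χ h * (ofTransitions t χ ht hχ hinc hlink).sig h = -(e * χ (G.mate h)) := by
    change e * χ h * -(χ h * χ (G.mate h)) = _
    rw [mul_neg, mul_assoc, ← mul_assoc (χ h), Int.units_mul_self, one_mul]
  simp only [reverse, h1, neg_neg]

theorem ofTransitions_iterate_faceStep (e : ℤˣ) (h : H) (n : ℕ) :
    (ofTransitions t χ ht hχ hinc hlink).faceStep^[n] (h, e * χ h) =
      ((t e ∘ G.mate)^[n] h, e * χ ((t e ∘ G.mate)^[n] h)) := by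
  induction n with
  | zero => rfl
  | succ n ih => rw [Function.iterate_succ_apply', ih, ofTransitions_faceStep,
      Function.iterate_succ_apply', Function.comp_apply]

theorem ofTransitions_facialWalk (e : ℤˣ) (h : H) :
    (ofTransitions t χ ht hχ hinc hlink).facialWalk (h, e * χ h) =
      Function.periodicOrbit (t e ∘ G.mate) h := by
  have hp : Function.minimalPeriod (ofTransitions t χ ht hχ hinc hlink).faceStep (h, e * χ h) =
      Function.minimalPeriod (t e ∘ G.mate) h := by
    rw [Function.minimalPeriod_eq_minimalPeriod_iff]
    intro n
    simp only [Function.IsPeriodicPt, Function.IsFixedPt, ofTransitions_iterate_faceStep,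
      Prod.mk.injEq, and_iff_left_iff_imp]
    intro h'
    rw [h']
  rw [facialWalk, hp, Function.periodicOrbit]
  congr 1
  apply List.ext_getElem <;> simp [ofTransitions_iterate_faceStep]

theorem ofTransitions_faceOf_eq (hmate : ∀ e x y, linkSetoid G.mate (t e) x y) (e : ℤˣ) (x y : H) :
    (ofTransitions t χ ht hχ hinc hlink).faceOf (x, e * χ x) =
      (ofTransitions t χ ht hχ hinc hlink).faceOf (y, e * χ y) := by
  have hm : ∀ z, (ofTransitions t χ ht hχ hinc hlink).faceOf (G.mate z, e * χ (G.mate z)) =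
      (ofTransitions t χ ht hχ hinc hlink).faceOf (z, e * χ z) := fun z =>
    (congrArg _ (ofTransitions_reverse e z).symm).trans (faceOf_reverse _ _)
  refine linkSetoid_apply_eq
    (f := fun z => (ofTransitions t χ ht hχ hinc hlink).faceOf (z, e * χ z)) hm (fun z => ?_)
    (hmate e x y)
  rw [← hm z, ← faceOf_faceStep _ (G.mate z, _), ofTransitions_faceStep, G.mate_mate]

/-- The invariant sign separates the two families of faces, and transitivity leaves one face in
each. -/
theorem ofTransitions_card_face [Nonempty H] (hmate : ∀ e x y, linkSetoid G.mate (t e) x y) :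
    Nat.card (ofTransitions t χ ht hχ hinc hlink).Face = 2 := by
  have hst : ∀ x : H × ℤˣ, x = (x.1, x.2 * χ x.1 * χ x.1) := fun x => by
    rw [mul_assoc, Int.units_mul_self, mul_one]
  let side : (ofTransitions t χ ht hχ hinc hlink).Face → ℤˣ :=
    Quot.lift (fun x => x.2 * χ x.1) (by
      rintro x y (rfl | rfl)
      · conv_rhs => rw [hst x, ofTransitions_faceStep]
        rw [mul_assoc _ (χ _) (χ _), Int.units_mul_self, mul_one]
      · conv_rhs => rw [hst x, ofTransitions_reverse]
        rw [mul_assoc _ (χ _) (χ _), Int.units_mul_self, mul_one])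
  have hbij : Function.Bijective side := by
    constructor
    · rintro ⟨x⟩ ⟨y⟩ hxy
      change x.2 * χ x.1 = y.2 * χ y.1 at hxy
      change (ofTransitions t χ ht hχ hinc hlink).faceOf x =
        (ofTransitions t χ ht hχ hinc hlink).faceOf y
      rw [hst x, hst y, hxy]
      exact ofTransitions_faceOf_eq hmate _ _ _
    · intro e
      obtain ⟨h⟩ := ‹Nonempty H›
      refine ⟨(ofTransitions t χ ht hχ hinc hlink).faceOf (h, e * χ h), ?_⟩
      change e * χ h * χ h = e
      rw [mul_assoc, Int.units_mul_self, mul_one]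
  rw [Nat.card_congr (Equiv.ofBijective side hbij)]
  simp

/-- The orbits of one family of transitions are euler circuits if that family, together with the
edges, is transitive. -/
theorem isEulerCircuit_periodicOrbit [Finite H] (hV : Function.Surjective G.inc) {ν : H → H}
    (hν : ν.Involutive) (hν' : ∀ h, ν h ≠ h) (hinc : ∀ h, G.inc (ν h) = G.inc h)
    (hmate : ∀ x y, linkSetoid G.mate ν x y) (h : H) :
    G.IsEulerCircuit (Function.periodicOrbit (ν ∘ G.mate) h) := by
  have hμ : G.mate.Involutive := G.mate_mate
  have hinj : Function.Injective (ν ∘ G.mate) := hν.injective.comp hμ.injective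
  have hper : h ∈ Function.periodicPts (ν ∘ G.mate) :=
    hinj.mem_periodicPts h
  -- Each step of the walk flips this color twice, so the walk never departs along both halves of an
  -- edge: no edge is repeated.
  obtain ⟨c, hcμ, hcν⟩ := exists_coloring hμ hν G.mate_ne hν'
  have hc : ∀ n, c ((ν ∘ G.mate)^[n] h) = c h := by
    intro n
    induction n with
    | zero => rfl
    | succ n ih => rw [Function.iterate_succ_apply', Function.comp_apply, hcν, hcμ, neg_neg, ih]
  have hmem : ∀ x, x ∈ Function.periodicOrbit (ν ∘ G.mate) h ∨
      G.mate x ∈ Function.periodicOrbit (ν ∘ G.mate) h := by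
    have hsc : ∀ x, (involutionProd hν hμ).SameCycle h x →
        x ∈ Function.periodicOrbit (ν ∘ G.mate) h := by
      intro x hx
      obtain ⟨n, rfl⟩ := hx.exists_nat_pow_eq
      rw [Equiv.Perm.coe_pow]
      exact Function.iterate_mem_periodicOrbit hper n
    intro x
    have := hmate h x
    rw [linkSetoid_comm] at this
    exact (sameCycle_or_of_linkSetoid hν hμ this).imp (hsc _) (hsc _)
  refine ⟨⟨?_, ?_⟩, ?_, fun v => ?_⟩
  · rw [IsClosedWalk, Function.periodicOrbit_chain' _ hper]
    intro n
    rw [Function.iterate_succ_apply', Function.comp_apply, hinc]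
  · have hnd := Function.nodup_periodicOrbit (f := ν ∘ G.mate) (x := h)
    rw [Function.periodicOrbit] at hnd ⊢
    rw [Cycle.map_coe, Cycle.nodup_coe_iff]
    rw [Cycle.nodup_coe_iff] at hnd
    refine List.Nodup.map_on ?_ hnd
    intro x hx y hy hxy
    simp only [List.mem_map] at hx hy
    obtain ⟨i, -, rfl⟩ := hx
    obtain ⟨j, -, rfl⟩ := hy
    simp only [edge, Sym2.eq_iff] at hxy
    rcases hxy with hxy | hxy
    · exact hxy.1
    · have := congrArg c hxy.1
      rw [hcμ, hc, hc] at this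
      exact absurd this.symm (units_ne_neg_self _).symm
  · rintro _ ⟨x, rfl⟩
    rw [Cycle.mem_map]
    rcases hmem x with hx | hx
    · exact ⟨x, hx, rfl⟩
    · exact ⟨_, hx, by rw [edge, edge, G.mate_mate, Sym2.eq_swap]⟩
  · obtain ⟨x, rfl⟩ := hV v
    rw [Cycle.mem_map]
    rcases hmem x with hx | hx
    · exact ⟨x, hx, rfl⟩
    · obtain ⟨n, hn⟩ := (Function.mem_periodicOrbit_iff hper).1 hx
      refine ⟨_, Function.iterate_mem_periodicOrbit hper (n + 1), ?_⟩
      rw [Function.iterate_succ_apply', hn, Function.comp_apply, G.mate_mate, hinc]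

end OfTransitions

end CellularEmbedding

end HalfEdgeGraph

/-! ### Faces bounded by circuits in an arbitrary embedding -/

namespace HalfEdgeGraph

variable {V : Type*} {H : Type*} {G : HalfEdgeGraph V H}

theorem edge_mate (h : H) : G.edge (G.mate h) = G.edge h := by
  rw [edge, edge, G.mate_mate, Sym2.eq_swap]

theorem edge_eq_edge_iff {x y : H} : G.edge x = G.edge y ↔ x = y ∨ x = G.mate y := by
  rw [edge, edge, Sym2.eq_iff]
  constructor
  · rintro (h | h)
    exacts [Or.inl h.1, Or.inr h.1]
  · rintro (rfl | rfl)
    exacts [Or.inl ⟨rfl, rfl⟩, Or.inr ⟨rfl, G.mate_mate _⟩]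

namespace CellularEmbedding

section FaceTracing

variable (Φ : G.CellularEmbedding)

theorem reverse_reverse (x : H × ℤˣ) : Φ.reverse (Φ.reverse x) = x := by
  ext <;> simp [reverse, G.mate_mate, Φ.sig_mate, mul_assoc, Int.units_mul_self]

/-- Reversal conjugates face tracing to its inverse; injectivity and the description of faces by
orbits follow from this. -/
theorem faceStep_reverse_faceStep (x : H × ℤˣ) :
    Φ.faceStep (Φ.reverse (Φ.faceStep x)) = Φ.reverse x := by
  have h1 : (Φ.reverse (Φ.faceStep x)).2 * Φ.sig (Φ.reverse (Φ.faceStep x)).1 =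
      -(x.2 * Φ.sig x.1) := by
    simp [reverse, faceStep, Φ.sig_mate, mul_assoc, Int.units_mul_self]
  rw [faceStep, h1]
  simp only [reverse, faceStep, G.mate_mate, Units.val_neg, zpow_neg]
  exact Prod.ext ((Φ.rot ^ _).symm_apply_apply _) rfl

theorem faceStep_injective : Function.Injective Φ.faceStep := by
  have : Function.LeftInverse (Φ.reverse ∘ Φ.faceStep ∘ Φ.reverse) Φ.faceStep := fun x => by
    simp only [Function.comp_apply, faceStep_reverse_faceStep, reverse_reverse]
  exact this.injective

theorem facialWalk_eq_map_periodicOrbit (x : H × ℤˣ) :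
    Φ.facialWalk x = (Function.periodicOrbit Φ.faceStep x).map Prod.fst := by
  rw [facialWalk, Function.periodicOrbit, Cycle.map_coe]
  congr 2
  apply List.ext_getElem <;> simp

variable {Φ} {x y z : H × ℤˣ}

theorem eq_of_edge_eq (hx : ((Φ.facialWalk x).map G.edge).Nodup)
    (hy : y ∈ Function.periodicOrbit Φ.faceStep x) (hz : z ∈ Function.periodicOrbit Φ.faceStep x)
    (h : G.edge y.1 = G.edge z.1) : y = z := by
  rw [facialWalk_eq_map_periodicOrbit, Function.periodicOrbit, Cycle.map_coe, Cycle.map_coe,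
    Cycle.nodup_coe_iff, List.map_map] at hx
  exact List.inj_on_of_nodup_map hx hy hz h

theorem mem_facialWalk {h : H} :
    h ∈ Φ.facialWalk x ↔ ∃ y ∈ Function.periodicOrbit Φ.faceStep x, y.1 = h := by
  rw [facialWalk_eq_map_periodicOrbit, Cycle.mem_map]

variable [Finite H]

theorem mem_periodicPts_faceStep : x ∈ Function.periodicPts Φ.faceStep :=
  Φ.faceStep_injective.mem_periodicPts x

theorem faceStep_mem_periodicOrbit_iff :
    Φ.faceStep y ∈ Function.periodicOrbit Φ.faceStep x ↔
      y ∈ Function.periodicOrbit Φ.faceStep x := by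
  rw [Function.mem_periodicOrbit_iff mem_periodicPts_faceStep,
    Function.mem_periodicOrbit_iff mem_periodicPts_faceStep]
  constructor
  · rintro ⟨n, hn⟩
    rw [← Function.iterate_add_minimalPeriod_eq] at hn
    obtain ⟨k, hk⟩ := Nat.exists_eq_add_of_lt
      (Function.minimalPeriod_pos_of_mem_periodicPts (mem_periodicPts_faceStep (Φ := Φ) (x := x)))
    rw [hk, show n + (0 + k + 1) = n + k + 1 by ring, Function.iterate_succ_apply'] at hn
    exact ⟨n + k, Φ.faceStep_injective hn⟩
  · rintro ⟨n, hn⟩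
    exact ⟨n + 1, by rw [Function.iterate_succ_apply', hn]⟩

/-- The states of a face form a single tracing orbit together with its reversal, since this union is
closed under both generating moves. -/
theorem mem_periodicOrbit_of_faceOf_eq (h : Φ.faceOf y = Φ.faceOf x) :
    y ∈ Function.periodicOrbit Φ.faceStep x ∨ Φ.reverse y ∈ Function.periodicOrbit Φ.faceStep x := by
  let P : Φ.Face → Prop :=
    Quot.lift (fun y => y ∈ Function.periodicOrbit Φ.faceStep x ∨
      Φ.reverse y ∈ Function.periodicOrbit Φ.faceStep x) (by
      rintro y _ (rfl | rfl)
      · rw [faceStep_mem_periodicOrbit_iff,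
          ← faceStep_mem_periodicOrbit_iff (y := Φ.reverse (Φ.faceStep y)),
          faceStep_reverse_faceStep]
      · rw [reverse_reverse, or_comm])
  have : P (Φ.faceOf x) := Or.inl (Function.self_mem_periodicOrbit mem_periodicPts_faceStep)
  rwa [← h] at this

/-- A face bounded by a circuit lies on one side only of its edges. -/
theorem faceOf_neg_ne (hx : ((Φ.facialWalk x).map G.edge).Nodup) :
    Φ.faceOf (x.1, -x.2) ≠ Φ.faceOf x := by
  intro h
  have hself : x ∈ Function.periodicOrbit Φ.faceStep x :=
    Function.self_mem_periodicOrbit mem_periodicPts_faceStep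
  rcases mem_periodicOrbit_of_faceOf_eq h with h | h
  · exact units_ne_neg_self x.2 (congrArg Prod.snd (eq_of_edge_eq hx hself h rfl))
  · exact G.mate_ne x.1 (congrArg Prod.fst (eq_of_edge_eq hx h hself (edge_mate x.1)))

theorem two_le_card_face {c : Cycle H} (hc : (c.map G.edge).Nodup) (hΦ : Φ.HasFaceBoundedBy c) :
    2 ≤ Nat.card Φ.Face := by
  obtain ⟨_, x, -, rfl⟩ := hΦ
  have : Finite Φ.Face := inferInstanceAs (Finite (Quot _))
  have : _root_.Nontrivial Φ.Face := ⟨_, _, faceOf_neg_ne hc⟩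
  exact Finite.one_lt_card

theorem eulerGenus_le {c : Cycle H} (hc : (c.map G.edge).Nodup)
    (hΦ : Φ.HasFaceBoundedBy c) :
    Φ.eulerGenus ≤ (G.edgeSet.ncard : ℤ) - (Nat.card V : ℤ) := by
  have := two_le_card_face hc hΦ
  rw [eulerGenus]
  omega

omit [Finite H] in
theorem IsBiEulerian.eulerGenus_eq (hΦ : Φ.IsBiEulerian) :
    Φ.eulerGenus = (G.edgeSet.ncard : ℤ) - (Nat.card V : ℤ) := by
  rw [eulerGenus, hΦ.1]
  ring

/-- An embedding of a cycle is orientable if some face is bounded by an euler circuit. -/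
theorem isOrientable_of_degree_eq_two {c : Cycle H} (hdeg : ∀ v, G.degree v = 2)
    (hc : G.IsEulerCircuit c) (hΦ : Φ.HasFaceBoundedBy c) : Φ.IsOrientable := by
  obtain ⟨_, x, -, rfl⟩ := hΦ
  obtain ⟨⟨-, hnd⟩, hE, hV⟩ := hc
  have hstate : ∀ v, ∃ y ∈ Function.periodicOrbit Φ.faceStep x, G.inc y.1 = v := fun v => by
    obtain ⟨h, hh, rfl⟩ := Cycle.mem_map.1 (hV v)
    obtain ⟨y, hy, rfl⟩ := mem_facialWalk.1 hh
    exact ⟨y, hy, rfl⟩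
  choose st hst hinc using hstate
  have hprev : ∀ y ∈ Function.periodicOrbit Φ.faceStep x,
      ∃ z ∈ Function.periodicOrbit Φ.faceStep x, Φ.faceStep z = y := fun y hy => by
    obtain ⟨z, rfl⟩ := (Finite.injective_iff_surjective.1 Φ.faceStep_injective) y
    exact ⟨z, faceStep_mem_periodicOrbit_iff.1 hy, rfl⟩
  have hstep : ∀ z : H × ℤˣ, G.inc (Φ.faceStep z).1 = G.inc (G.mate z.1) := fun z => by
    have : ∀ h, G.inc (Φ.rot⁻¹ h) = G.inc h := fun h => by
      exact (Φ.inc_rot (Φ.rot⁻¹ h)).symm.trans (congrArg G.inc (Φ.rot.apply_symm_apply h))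
    rw [faceStep]
    rcases Int.units_eq_one_or (z.2 * Φ.sig z.1) with h | h
    · simp [h, Φ.inc_rot]
    · simpa [h] using this _
  -- One of the two half-edges at a vertex is used for arriving, hence never for departing, so only
  -- one departure from the vertex is possible.
  have huniq : ∀ y ∈ Function.periodicOrbit Φ.faceStep x,
      ∀ z ∈ Function.periodicOrbit Φ.faceStep x, G.inc y.1 = G.inc z.1 → y = z := by
    intro y hy z hz hyz
    obtain ⟨w, hw, rfl⟩ := hprev y hy
    obtain ⟨a, b, hab, hset⟩ := Set.ncard_eq_two.1 (hdeg (G.inc z.1))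
    have hmem : ∀ h, G.inc h = G.inc z.1 → h = a ∨ h = b := fun h hh => by
      have : h ∈ G.inc ⁻¹' {G.inc z.1} := hh
      rwa [hset] at this
    have h1 := hmem _ hyz
    have h2 := hmem z.1 rfl
    have h3 := hmem (G.mate w.1) (by rw [← hstep, hyz])
    have h4 : ∀ u ∈ Function.periodicOrbit Φ.faceStep x, u.1 ≠ G.mate w.1 := fun u hu h => by
      have : u = w := eq_of_edge_eq hnd hu hw (by rw [h, edge_mate])
      exact G.mate_ne w.1 (by rw [← h, this])
    have h5 := h4 _ hy
    have h6 := h4 z hz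
    refine eq_of_edge_eq hnd hy hz (congrArg G.edge ?_)
    grind
  -- The orientation at `v` is the sense in which the face passes its unique state there; a step
  -- multiplies this sense by the signature of the edge.
  refine ⟨fun v => (st v).2, fun h => ?_⟩
  have hmain : ∀ y ∈ Function.periodicOrbit Φ.faceStep x,
      Φ.sig y.1 = (st (G.inc y.1)).2 * (st (G.inc (G.mate y.1))).2 := by
    intro y hy
    rw [huniq _ (hst _) y hy (hinc _), huniq _ (hst _) _ (faceStep_mem_periodicOrbit_iff.2 hy)
      ((hinc _).trans (hstep y).symm)]
    simp only [faceStep, ← mul_assoc, Int.units_mul_self, one_mul]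
  obtain ⟨g, hg, hgh⟩ := Cycle.mem_map.1 (hE _ ⟨h, rfl⟩)
  obtain ⟨y, hy, rfl⟩ := mem_facialWalk.1 hg
  rcases edge_eq_edge_iff.1 hgh with h' | h'
  · rw [← h', hmain y hy]
  · have := hmain y hy
    rwa [h', Φ.sig_mate, G.mate_mate, mul_comm] at this

end FaceTracing

end CellularEmbedding

end HalfEdgeGraph

/-! ### Cyclic sequences as orbits -/

section PeriodicOrbit

open Function

variable {α : Type*}

theorem periodicOrbit_congr {f g : α → α} {x : α} (h : ∀ n, f^[n] x = g^[n] x) :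
    periodicOrbit f x = periodicOrbit g x := by
  have hp : minimalPeriod f x = minimalPeriod g x := by
    rw [minimalPeriod_eq_minimalPeriod_iff]
    intro n
    rw [IsPeriodicPt, IsPeriodicPt, IsFixedPt, IsFixedPt, h]
  simp only [periodicOrbit, hp, h]

/-- A cycle without repetitions is an orbit of a permutation. -/
theorem exists_periodicOrbit_eq {c : Cycle α} (hc : c.Nodup) (hne : c ≠ Cycle.nil) :
    ∃ (p : Equiv.Perm α) (x : α), x ∈ periodicPts p ∧ periodicOrbit p x = c ∧
      ∀ y, p y ∈ c ↔ y ∈ c := by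
  classical
  induction c using Quotient.inductionOn' with
  | h l =>
  rw [Cycle.mk''_eq_coe] at *
  obtain ⟨a, l, rfl⟩ := List.exists_cons_of_ne_nil (mt (Cycle.coe_eq_nil l).2 hne)
  rw [Cycle.nodup_coe_iff] at hc
  have hiter : ∀ n, (a :: l).formPerm^[n] a =
      (a :: l)[n % (a :: l).length]'(Nat.mod_lt _ (by simp)) := by
    intro n
    rw [← Equiv.Perm.coe_pow]
    exact (List.formPerm_pow_apply_getElem (a :: l) hc n 0 (by simp)).trans
      (by simp only [Nat.zero_add])
  have hperiod : ∀ n, IsPeriodicPt (a :: l).formPerm n a ↔ (a :: l).length ∣ n := by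
    intro n
    rw [IsPeriodicPt, IsFixedPt, hiter, Nat.dvd_iff_mod_eq_zero]
    constructor
    · intro h
      exact (List.Nodup.getElem_inj_iff hc (hj := by simp)).1 (h.trans (List.getElem_cons_zero ..).symm)
    · intro h
      simp only [h, List.getElem_cons_zero]
  have hmin : minimalPeriod (a :: l).formPerm a = (a :: l).length :=
    Nat.dvd_antisymm (((hperiod _).2 dvd_rfl).minimalPeriod_dvd)
      ((hperiod _).1 (isPeriodicPt_minimalPeriod _ _))
  refine ⟨(a :: l).formPerm, a, ?_, ?_, fun y => List.formPerm_mem_iff_mem⟩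
  · rw [← minimalPeriod_pos_iff_mem_periodicPts, hmin]
    simp
  · rw [periodicOrbit, hmin]
    congr 1
    refine List.ext_getElem (by simp) fun i h1 h2 => ?_
    simp only [List.getElem_map, List.getElem_range, hiter, Nat.mod_eq_of_lt h2]

end PeriodicOrbit

/-! ### From an euler circuit to its transitions, and the final construction -/

namespace HalfEdgeGraph

variable {V : Type*} {H : Type*} {G : HalfEdgeGraph V H} {T : Cycle H}

theorem IsEulerCircuit.inc_surjective (hT : G.IsEulerCircuit T) : Function.Surjective G.inc :=
  fun v => by
    obtain ⟨h, -, hh⟩ := Cycle.mem_map.1 (hT.2.2 v)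
    exact ⟨h, hh⟩

theorem IsCircuit.mate_notMem (hT : G.IsCircuit T) {h : H} (hh : h ∈ T) : G.mate h ∉ T := by
  intro hm
  have hnd := hT.2
  induction T using Quotient.inductionOn' with
  | h l =>
  exact G.mate_ne h (List.inj_on_of_nodup_map hnd hm hh (edge_mate h))

theorem IsCircuit.nodup (hT : G.IsCircuit T) : T.Nodup := by
  have hnd := hT.2
  induction T using Quotient.inductionOn' with
  | h l => exact List.Nodup.of_map _ hnd

theorem IsEulerCircuit.mate_mem_iff (hT : G.IsEulerCircuit T) (h : H) : G.mate h ∈ T ↔ h ∉ T := by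
  refine ⟨fun hm hh => hT.1.mate_notMem hh hm, fun hh => ?_⟩
  obtain ⟨g, hg, hgh⟩ := Cycle.mem_map.1 (hT.2.1 _ ⟨h, rfl⟩)
  rcases edge_eq_edge_iff.1 hgh with rfl | rfl
  · exact absurd hg hh
  · exact hg

/-- The transitions of an euler circuit, together with the coloring of the half-edges according to
its direction. -/
theorem IsEulerCircuit.exists_transitions (hG : G.Nontrivial) (hT : G.IsEulerCircuit T) :
    ∃ (τ : H → H) (c : H → ℤˣ) (x : H), τ.Involutive ∧ (∀ h, c (τ h) = -c h) ∧
      (∀ h, c (G.mate h) = -c h) ∧ (∀ h, G.inc (τ h) = G.inc h) ∧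
      (∀ g h, linkSetoid G.mate τ g h) ∧ Function.periodicOrbit (τ ∘ G.mate) x = T := by
  classical
  have hne : T ≠ Cycle.nil := by
    rintro rfl
    obtain ⟨e, he⟩ := hG
    exact Cycle.notMem_nil _ (hT.2.1 e he)
  obtain ⟨p, x, hx, hpT, hp⟩ := exists_periodicOrbit_eq hT.1.nodup hne
  have hpi : ∀ y, p.symm y ∈ T ↔ y ∈ T := fun y => by rw [← hp, Equiv.apply_symm_apply]
  have hwalk : ∀ y ∈ T, G.inc (p y) = G.inc (G.mate y) := by
    have h1 := hT.1.1
    rw [IsClosedWalk, ← hpT, Function.periodicOrbit_chain' _ hx] at h1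
    intro y hy
    rw [← hpT, Function.mem_periodicOrbit_iff hx] at hy
    obtain ⟨n, rfl⟩ := hy
    rw [h1 n, Function.iterate_succ_apply']
  -- `T` contains exactly one half of each edge, the departing one. A departing half-edge is paired
  -- with the arriving half-edge just before it on `T`, and conversely.
  let τ : H → H := fun z => if z ∈ T then G.mate (p.symm z) else p (G.mate z)
  have hτ1 : ∀ z ∈ T, τ z = G.mate (p.symm z) := fun z hz => if_pos hz
  have hτ2 : ∀ z ∉ T, τ z = p (G.mate z) := fun z hz => if_neg hz
  have hτT : ∀ z, τ z ∈ T ↔ z ∉ T := fun z => by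
    by_cases hz : z ∈ T
    · rw [hτ1 z hz, hT.mate_mem_iff, hpi]
    · rw [hτ2 z hz, hp, hT.mate_mem_iff]
  have hτm : ∀ y ∈ T, τ (G.mate y) = p y := fun y hy => by
    rw [hτ2 _ (hT.1.mate_notMem hy), G.mate_mate]
  have hiter : ∀ n, (τ ∘ G.mate)^[n] x = p^[n] x := by
    intro n
    induction n with
    | zero => rfl
    | succ n ih =>
      rw [Function.iterate_succ_apply', Function.iterate_succ_apply', ih, Function.comp_apply, hτm]
      rw [← hpT]
      exact Function.iterate_mem_periodicOrbit hx n
  have hlinkT : ∀ y ∈ T, linkSetoid G.mate τ x y := by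
    intro y hy
    rw [← hpT, Function.mem_periodicOrbit_iff hx] at hy
    obtain ⟨n, rfl⟩ := hy
    rw [← hiter]
    induction n with
    | zero => exact (linkSetoid G.mate τ).refl x
    | succ n ih =>
      rw [Function.iterate_succ_apply']
      exact (linkSetoid G.mate τ).trans ih
        ((linkSetoid G.mate τ).trans (linkSetoid_left _ _ _) (linkSetoid_right _ _ _))
  have hlink : ∀ y, linkSetoid G.mate τ x y := fun y => by
    by_cases hy : y ∈ T
    · exact hlinkT y hy
    · exact (linkSetoid G.mate τ).trans (hlinkT _ ((hT.mate_mem_iff y).2 hy))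
        ((linkSetoid G.mate τ).symm (linkSetoid_left _ _ _))
  refine ⟨τ, fun z => if z ∈ T then 1 else -1, x, fun z => ?_, fun z => ?_, fun z => ?_,
    fun z => ?_, fun y z => (linkSetoid G.mate τ).trans ((linkSetoid G.mate τ).symm (hlink y))
      (hlink z), (periodicOrbit_congr hiter).trans hpT⟩
  · by_cases hz : z ∈ T
    · rw [hτ1 z hz, hτm _ ((hpi z).2 hz), Equiv.apply_symm_apply]
    · rw [hτ1 _ ((hτT z).2 hz), hτ2 z hz, Equiv.symm_apply_apply, G.mate_mate]
  · simp only [hτT]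
    split_ifs <;> simp_all
  · simp only [hT.mate_mem_iff]
    split_ifs <;> simp_all
  · by_cases hz : z ∈ T
    · rw [hτ1 z hz, ← hwalk _ ((hpi z).2 hz), Equiv.apply_symm_apply]
    · rw [hτ2 z hz, hwalk _ ((hT.mate_mem_iff z).2 hz), G.mate_mate]

theorem connected_of_linkSetoid {τ : H → H} [Nonempty H] (hV : Function.Surjective G.inc)
    (hinc : ∀ h, G.inc (τ h) = G.inc h) (hlink : ∀ g h, linkSetoid G.mate τ g h) :
    G.Connected := by
  refine ⟨‹Nonempty H›.map G.inc, fun u v => ?_⟩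
  obtain ⟨g, rfl⟩ := hV u
  obtain ⟨h, rfl⟩ := hV v
  let r : V → V → Prop := fun a b => ∃ h, G.inc h = a ∧ G.inc (G.mate h) = b
  have hr : Std.Symm r := ⟨fun a b ⟨h, h1, h2⟩ => ⟨G.mate h, h2, by rw [G.mate_mate, h1]⟩⟩
  have hsymm : ∀ a b, Relation.ReflTransGen r a b → Relation.ReflTransGen r b a :=
    (Relation.ReflTransGen.stdSymm (r := r)).symm
  let s : Setoid H :=
    { r := fun g h => Relation.ReflTransGen r (G.inc g) (G.inc h)
      iseqv := ⟨fun _ => .refl, fun h => hsymm _ _ h, fun h h' => h.trans h'⟩ }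
  refine linkSetoid_le (s := s) (fun x => ?_) (fun x => ?_) (hlink g h)
  · exact .single ⟨x, rfl, rfl⟩
  · change Relation.ReflTransGen r (G.inc x) (G.inc (τ x))
    rw [hinc]

namespace CellularEmbedding

/-- Two transitive families of transitions that alternate around every vertex yield a bi-eulerian
embedding. -/
theorem exists_isBiEulerian [Finite H] [Nonempty H] (hV : Function.Surjective G.inc) {τ ν : H → H}
    (hτ : τ.Involutive) (hτ' : ∀ h, τ h ≠ h) (hfτ : ∀ h, G.inc (τ h) = G.inc h)
    (hν : ν.Involutive) (hν' : ∀ h, ν h ≠ h) (hfν : ∀ h, G.inc (ν h) = G.inc h)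
    (hμτ : ∀ g h, linkSetoid G.mate τ g h) (hμν : ∀ g h, linkSetoid G.mate ν g h)
    (hτν : ∀ g h, G.inc g = G.inc h → linkSetoid τ ν g h) :
    ∃ Φ : G.CellularEmbedding, Φ.IsBiEulerian ∧
      (∀ x, Φ.HasFaceBoundedBy (Function.periodicOrbit (τ ∘ G.mate) x)) ∧
      (Φ.IsOrientable → ∀ c : H → ℤˣ, (∀ h, c (G.mate h) = -c h) → (∀ h, c (τ h) = -c h) →
        ∀ h, c (ν h) = -c h) := by
  obtain ⟨χ, hχτ, hχν⟩ := exists_coloring hτ hν hτ' hν'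
  let t : ℤˣ → H → H := fun e => if e = 1 then ν else τ
  have h1 : t 1 = ν := rfl
  have h2 : t (-1) = τ := if_neg (by decide)
  have hall : ∀ P : (H → H) → Prop, P τ → P ν → ∀ e, P (t e) := fun P hPτ hPν e => by
    rcases Int.units_eq_one_or e with rfl | rfl
    · rwa [h1]
    · rwa [h2]
  have hmate := hall (fun f => ∀ g h, linkSetoid G.mate f g h) hμτ hμν
  have hinc := hall (fun f => ∀ h, G.inc (f h) = G.inc h) hfτ hfν
  refine ⟨ofTransitions t χ (hall _ hτ hν) (hall (fun f => ∀ h, χ (f h) = -χ h) hχτ hχν) hinc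
    (by rwa [h1, h2]), ⟨ofTransitions_card_face hmate, ?_⟩, fun x => ?_, ?_⟩
  · rintro ⟨h, s⟩
    refine ⟨_, isEulerCircuit_periodicOrbit hV (hall _ hτ hν (s * χ h))
      (hall (fun f => ∀ h, f h ≠ h) hτ' hν' _) (hinc _) (hmate _) h, (h, s), rfl, ?_⟩
    rw [← ofTransitions_facialWalk, mul_assoc, Int.units_mul_self, mul_one]
  · exact ⟨_, _, rfl, by rw [ofTransitions_facialWalk (-1) x, h2]⟩
  · rintro ⟨ε, hε⟩ c hcμ hcτ h
    -- Both `c` and `χ * ε` change sign under `mate` and under `τ`, so their product is constant by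
    -- transitivity. Since `ν` flips `χ` and fixes `ε`, it must flip `c`.
    have hconst : ∀ g h, c g * (χ g * ε (G.inc g)) = c h * (χ h * ε (G.inc h)) := fun g h => by
      refine linkSetoid_apply_eq (f := fun h => c h * (χ h * ε (G.inc h))) (fun z => ?_)
        (fun z => by rw [hcτ, hχτ, hfτ, neg_mul, neg_mul, mul_neg, neg_neg]) (hμτ g h)
      have h3 : -(χ z * χ (G.mate z)) = ε (G.inc z) * ε (G.inc (G.mate z)) := hε z
      have h4 : χ (G.mate z) * ε (G.inc (G.mate z)) = -(χ z * ε (G.inc z)) := by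
        have := congrArg (fun u => χ z * u * ε (G.inc (G.mate z))) h3
        simp only [mul_neg, neg_mul] at this
        rw [← mul_assoc, Int.units_mul_self, one_mul, mul_assoc, mul_assoc, Int.units_mul_self,
          mul_one] at this
        rw [← this, neg_neg]
      rw [h4, hcμ, neg_mul, mul_neg, neg_neg]
    have := hconst (ν h) h
    rw [hχν, hfν, neg_mul, mul_neg, ← neg_mul] at this
    rw [← mul_right_cancel this, neg_neg]

end CellularEmbedding

end HalfEdgeGraph

theorem mainTheorem6 {V : Type*} {H : Type*} [Finite V] [Finite H] (G : HalfEdgeGraph V H)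
    (hG : G.Nontrivial) (T : Cycle H) (hT : G.IsEulerCircuit T) :
    (∃ Φ : G.CellularEmbedding, Φ.IsBiEulerian ∧ Φ.HasFaceBoundedBy T) ∧
    ((∃ Φ : G.CellularEmbedding, Φ.IsBiEulerian ∧ Φ.HasFaceBoundedBy T ∧ ¬ Φ.IsOrientable) ↔
      ¬ G.IsCycle) ∧
    ∀ Φ : G.CellularEmbedding, Φ.IsBiEulerian → Φ.HasFaceBoundedBy T →
      Φ.eulerGenus = (G.edgeSet.ncard : ℤ) - (Nat.card V : ℤ) ∧
      (∀ Ψ : G.CellularEmbedding, Ψ.HasFaceBoundedBy T → Ψ.eulerGenus ≤ Φ.eulerGenus) ∧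
      (Φ.IsOrientable → ∀ Ψ : G.CellularEmbedding, Ψ.HasFaceBoundedBy T → Ψ.IsOrientable →
        Ψ.genus ≤ Φ.genus) ∧
      (¬ Φ.IsOrientable → ∀ Ψ : G.CellularEmbedding, Ψ.HasFaceBoundedBy T → ¬ Ψ.IsOrientable →
        Ψ.genus ≤ Φ.genus) := by
  have hV := hT.inc_surjective
  obtain ⟨τ, c, x, hτ, hcτ, hcμ, hfτ, hμτ, hx⟩ := hT.exists_transitions hG
  have : Nonempty H := ⟨x⟩
  have hτ' : ∀ h, τ h ≠ h := fun h hh => units_ne_neg_self (c h) (by rw [← hcτ, hh])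
  have hnon : ∀ y z, G.inc y = G.inc z → y ≠ z → z ≠ τ y →
      ∃ Φ : G.CellularEmbedding, Φ.IsBiEulerian ∧ Φ.HasFaceBoundedBy T ∧ ¬ Φ.IsOrientable := by
    intro y z h1 h2 h3
    obtain ⟨ν, hν, hν', hfν, hμν, hτν, w, hw⟩ := exists_reconnection_of_color_eq G.mate_mate
      G.mate_ne hτ hτ' hfτ hμτ hcμ hcτ h1 h2 h3
    obtain ⟨Φ, hΦ, hΦT, hΦo⟩ := HalfEdgeGraph.CellularEmbedding.exists_isBiEulerian hV hτ hτ' hfτ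
      hν hν' hfν hμτ hμν hτν
    refine ⟨Φ, hΦ, hx ▸ hΦT x, fun ho => units_ne_neg_self (c w) ?_⟩
    rw [← hΦo ho c hcμ hcτ w, hw]
  refine ⟨?_, ⟨?_, fun hcyc => ?_⟩, fun Φ hΦ hΦT => ?_⟩
  · by_cases h : ∃ y z, G.inc y = G.inc z ∧ y ≠ z ∧ z ≠ τ y
    · obtain ⟨y, z, h1, h2, h3⟩ := h
      obtain ⟨Φ, hΦ, hΦT, -⟩ := hnon y z h1 h2 h3
      exact ⟨Φ, hΦ, hΦT⟩
    · push Not at h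
      -- Here every vertex has only the half-edges `y` and `τ y`, so `τ` itself can serve as the
      -- second family of corners.
      obtain ⟨Φ, hΦ, hΦT, -⟩ := HalfEdgeGraph.CellularEmbedding.exists_isBiEulerian hV hτ hτ' hfτ
        hτ hτ' hfτ hμτ hμτ (fun y z hyz => by
          by_cases h2 : y = z
          · rw [h2]
          · rw [h y z hyz h2]
            exact linkSetoid_left _ _ _)
      exact ⟨Φ, hΦ, hx ▸ hΦT x⟩
  · rintro ⟨Φ, -, hΦT, hΦo⟩ ⟨-, hdeg⟩
    exact hΦo (HalfEdgeGraph.CellularEmbedding.isOrientable_of_degree_eq_two hdeg hT hΦT)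
  -- If `hnon` never applies, every fiber of `inc` is a pair `{y, τ y}`, so all degrees are 2.
  · by_contra hno
    refine hcyc ⟨HalfEdgeGraph.connected_of_linkSetoid hV hfτ hμτ, fun v => ?_⟩
    obtain ⟨y, rfl⟩ := hV v
    refine Set.ncard_eq_two.2 ⟨y, τ y, (hτ' y).symm, Set.ext fun z => ⟨fun hz => ?_, ?_⟩⟩
    · by_contra hz'
      simp only [Set.mem_insert_iff, Set.mem_singleton_iff, not_or] at hz'
      exact hno (hnon y z (Eq.symm hz) (Ne.symm hz'.1) hz'.2)
    · rintro (rfl | rfl)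
      exacts [rfl, hfτ y]
  · have hle : ∀ Ψ : G.CellularEmbedding, Ψ.HasFaceBoundedBy T → Ψ.eulerGenus ≤ Φ.eulerGenus :=
      fun Ψ hΨ => hΦ.eulerGenus_eq ▸ HalfEdgeGraph.CellularEmbedding.eulerGenus_le hT.1.2 hΨ
    refine ⟨hΦ.eulerGenus_eq, hle, fun ho Ψ hΨ hΨo => ?_, fun ho Ψ hΨ hΨo => ?_⟩
    · have : (Ψ.eulerGenus : ℚ) ≤ Φ.eulerGenus := by exact_mod_cast hle Ψ hΨ
      rw [HalfEdgeGraph.CellularEmbedding.genus, HalfEdgeGraph.CellularEmbedding.genus, if_pos ho,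
        if_pos hΨo]
      linarith
    · rw [HalfEdgeGraph.CellularEmbedding.genus, HalfEdgeGraph.CellularEmbedding.genus, if_neg ho,
        if_neg hΨo]
      exact_mod_cast hle Ψ hΨ
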